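/- Let $\tfrac12<p<1$ and let $\eta$ be a random variable with values in $\{0,1,2,\dots\}$. Consider the following frog model on $\mathbb{Z}$. At time $0$ there is one active frog at the origin and, for each $x\in\mathbb{Z}\setminus\{0\}$, there are $\eta_x$ sleeping frogs at $x$, where the $\eta_x$ are independent and distributed as $\eta$. Once activated, a frog performs a discrete-time nearest-neighbour random walk from its starting site that steps left with probability $p$ and right with probability $1-p$; the walks of distinct frogs are independent of each other and of the family $(\eta_x)$. Sleeping frogs do not move, and whenever an active frog lands on a site that contains sleeping frogs, all of them become active. Then $$\mathbb{P}(\text{the origin is visited infinitely often})=\begin{cases}0&\text{if }\mathbb{E}[\log^+\eta]<\infty,\\ 1&\text{if }\mathbb{E}[\log^+\eta]=\infty,\end{cases}$$ where $\log^+ t=\max(0,\log t)$ and $\log^+0=0$; the origin is visited infinitely often if for infinitely many times $n$ some active frog is at the origin at time $n$. -/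

import Mathlib

open MeasureTheory Filter

namespace FrogModel

/-- The randomness of the two-sided frog model on `ℤ`. -/
abbrev Sample : Type := (ℤ → ℕ) × (ℤ × ℕ × ℕ → ℤ)

/-- The number of frogs at site `x` at time `0`: exactly one frog at the origin, and
`ω.1 x` sleeping frogs at each site `x ≠ 0`. -/
def frogs (ω : Sample) (x : ℤ) : ℕ := if x = 0 then 1 else ω.1 x

/-- The position, `a` steps after its activation, of the frog number `i` that starts at `x`;
its successive steps are `ω.2 (x, i, 0), ω.2 (x, i, 1), …`. -/
def position (ω : Sample) (x : ℤ) (i a : ℕ) : ℤ := x + ∑ l ∈ Finset.range a, ω.2 (x, i, l)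

open Classical in
/-- The state at time `n` of the frogs that start at `x`. It is `none` while they are asleep
(the site `x` has not been landed on), and `some a` if they were activated `a` time units ago.
At time `0` only the origin is awake. In every time unit each active frog makes one step of its
walk, and the frogs of a site are activated at the first time when an active frog lands there. -/
noncomputable def age (ω : Sample) : ℕ → ℤ → Option ℕ
  | 0 => fun x => if x = 0 then some 0 else none
  | n + 1 => fun x =>
      match age ω n x with
      | some a => some (a + 1)
      | none =>
          if ∃ y a i, age ω n y = some a ∧ i < frogs ω y ∧ position ω y i (a + 1) = x then some 0
          else none

/-- Some active frog is at the origin at time `n`. -/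
def OriginVisitedAt (ω : Sample) (n : ℕ) : Prop :=
  ∃ x a i, age ω n x = some a ∧ i < frogs ω x ∧ position ω x i a = 0

/-- The event that the origin is visited infinitely often. -/
def originVisitedIO : Set Sample := {ω | ∃ᶠ n in atTop, OriginVisitedAt ω n}

/-- The law of one step: `-1` with probability `p`, `+1` with probability `1 - p`. -/
noncomputable def stepLaw (p : ℝ) : Measure ℤ :=
  ENNReal.ofReal p • Measure.dirac (-1) + ENNReal.ofReal (1 - p) • Measure.dirac 1

/-- The law of the model: the numbers of frogs are i.i.d. with law `ν`, the steps are i.i.d. with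
law `stepLaw p`, and the two families are independent. -/
noncomputable def law (ν : Measure ℕ) (p : ℝ) : Measure Sample :=
  (Measure.infinitePi fun _ : ℤ => ν).prod (Measure.infinitePi fun _ : ℤ × ℕ × ℕ => stepLaw p)

theorem isProbabilityMeasure_stepLaw {p : ℝ} (h0 : 0 ≤ p) (h1 : p ≤ 1) :
    IsProbabilityMeasure (stepLaw p) := by
  constructor
  simp [stepLaw, ← ENNReal.ofReal_add h0 (sub_nonneg.2 h1)]

theorem isProbabilityMeasure_law (ν : Measure ℕ) [IsProbabilityMeasure ν] {p : ℝ}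
    (h0 : 0 ≤ p) (h1 : p ≤ 1) : IsProbabilityMeasure (law ν p) := by
  have := isProbabilityMeasure_stepLaw h0 h1
  unfold law
  infer_instance

end FrogModel

/-! Put ρ = (1 - p)/p < 1: a walk with this drift ever climbs k ≥ 0 levels with probability at most
ρ ^ k. The proof fixes the frog counts, works with the walks alone, and integrates by Fubini.

Finite log-moment. Let m = max 1 η and D(n) = ∑ₖ m(n - k) ρ ^ k, a bound for the expected number of
frogs from sites ≤ n that would ever climb to n. The law of large numbers for log m gives D(0) < ∞,
so only finitely many frogs from sites ≤ 0 have walks that reach 0. Since D(n + 1) = m(n + 1) + ρ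
D(n), D cannot stay large: it would shrink geometrically (`frequently_le_of_recursion`). Hence D ≤ M
infinitely often. At each such site, the walks from a finite block ending there all stay at or below
it with probability bounded below. Disjoint blocks are independent, and frogs behind a long block
are negligible, so some n is never crossed from the left (`ae_exists_barrier`). Then no site beyond
n wakes, finitely many frogs can visit 0, and each drifts away.

Infinite log-moment. The first frog drifts to -∞ by steps of size one, so it wakes every site -k.
Infinitely often η(-k) (1 - p) ^ k ≥ 1, so the second Borel–Cantelli lemma yields infinitely many
frogs that walk straight from -k to 0. -/

namespace FrogModel

open ProbabilityTheory
open scoped Topology ENNReal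

/-! ### Independence and the law of large numbers on product spaces -/

theorem iIndepSet_preimage {ι Ω : Type*} {β : ι → Type*} [MeasurableSpace Ω]
    [∀ i, MeasurableSpace (β i)] {μ : Measure Ω} {X : ∀ i, Ω → β i} (hX : iIndepFun X μ)
    (hm : ∀ i, Measurable (X i)) {B : ∀ i, Set (β i)} (hB : ∀ i, MeasurableSet (B i)) :
    iIndepSet (fun i => X i ⁻¹' B i) μ :=
  (iIndepSet_iff_meas_biInter fun i => hm i (hB i)).2 fun s =>
    hX.measure_inter_preimage_eq_mul s fun i _ => hB i

/-- The strong law of large numbers for the coordinates of a product measure. -/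
theorem ae_tendsto_average_infinitePi {ι X : Type*} [MeasurableSpace X] (ν : Measure X)
    [IsProbabilityMeasure ν] {f : X → ℝ} (hf : Measurable f) (hint : Integrable f ν)
    {g : ℕ → ι} (hg : Function.Injective g) :
    ∀ᵐ η ∂Measure.infinitePi fun _ : ι => ν,
      Tendsto (fun n : ℕ => (∑ i ∈ Finset.range n, f (η (g i))) / n) atTop (𝓝 (∫ x, f x ∂ν)) := by
  have hev : ∀ i : ι, MeasurePreserving (Function.eval i) (Measure.infinitePi fun _ : ι => ν) ν :=
    measurePreserving_eval_infinitePi (fun _ : ι => ν)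
  have hid : ∀ i : ι, IdentDistrib (fun η : ι → X => η i) id
      (Measure.infinitePi fun _ : ι => ν) ν := fun i =>
    ⟨(hev i).measurable.aemeasurable, aemeasurable_id, by
      rw [Measure.map_id]; exact (hev i).map_eq⟩
  have key := strong_law_ae_real (μ := Measure.infinitePi fun _ : ι => ν)
    (fun l η => f (η (g l))) ((hev (g 0)).integrable_comp_of_integrable hint)
    (fun i j hij => ((iIndepFun_infinitePi (P := fun _ : ι => ν)
      (X := fun _ => f) fun _ => hf).indepFun (hg.ne hij)))
    (fun l => ((hid (g l)).trans (hid (g 0)).symm).comp hf)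
  have hmean : ∫ η : ι → X, f (η (g 0)) ∂(Measure.infinitePi fun _ : ι => ν) = ∫ x, f x ∂ν := by
    rw [← (hev (g 0)).map_eq, integral_map (hev (g 0)).measurable.aemeasurable
      (by rw [(hev (g 0)).map_eq]; exact hint.aestronglyMeasurable)]
    simp only [(hev (g 0)).map_eq]
  rwa [hmean] at key

/-! ### A single walk with drift to the left -/

/-- The law of the steps of one frog. -/
noncomputable def pathLaw (p : ℝ) : Measure (ℕ → ℤ) := Measure.infinitePi fun _ : ℕ => stepLaw p

/-- The law of the steps of all frogs. -/
noncomputable def stepsLaw (p : ℝ) : Measure (ℤ × ℕ × ℕ → ℤ) :=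
  Measure.infinitePi fun _ : ℤ × ℕ × ℕ => stepLaw p

/-- The steps of the frog `z.2` that starts at `z.1`. -/
def walk (z : ℤ × ℕ) (s : ℤ × ℕ × ℕ → ℤ) : ℕ → ℤ := fun l => s (z.1, z.2, l)

/-- The displacement after `a` steps. -/
def displacement (u : ℕ → ℤ) (a : ℕ) : ℤ := ∑ l ∈ Finset.range a, u l

/-- The paths that climb to height at least `k`. -/
def reach (k : ℤ) : Set (ℕ → ℤ) := {u | ∃ a, k ≤ displacement u a}

/-- The path with first step `z.1` and further steps `z.2`. -/
def consPath (z : ℤ × (ℕ → ℤ)) : ℕ → ℤ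
  | 0 => z.1
  | n + 1 => z.2 n

theorem measurable_consPath : Measurable consPath := by
  refine measurable_pi_iff.2 fun n => ?_
  cases n
  · exact measurable_fst
  · exact (measurable_pi_apply _).comp measurable_snd

theorem displacement_consPath (z : ℤ × (ℕ → ℤ)) (a : ℕ) :
    displacement (consPath z) (a + 1) = displacement z.2 a + z.1 := by
  rw [displacement, Finset.sum_range_succ']
  rfl

theorem measurable_displacement (a : ℕ) : Measurable fun u => displacement u a := by
  unfold displacement
  fun_prop

theorem measurable_walk (z : ℤ × ℕ) : Measurable (walk z) := by
  unfold walk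
  fun_prop

theorem measurableSet_reach (k : ℤ) : MeasurableSet (reach k) := by
  have : reach k = ⋃ a, (fun u => displacement u a) ⁻¹' Set.Ici k := by
    ext u; simp [reach]
  rw [this]
  exact .iUnion fun a => measurable_displacement a (measurableSet_Ici)

section

variable {p : ℝ} [hP : IsProbabilityMeasure (stepLaw p)]

instance : IsProbabilityMeasure (pathLaw p) := by unfold pathLaw; infer_instance

instance : IsProbabilityMeasure (stepsLaw p) := by unfold stepsLaw; infer_instance

theorem map_walk (z : ℤ × ℕ) : (stepsLaw p).map (walk z) = pathLaw p :=
  Measure.map_infinitePi_infinitePi_of_inj (P := fun _ : ℤ × ℕ × ℕ => stepLaw p)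
    (f := fun l : ℕ => (z.1, z.2, l)) fun a b h => by simpa using h

theorem iIndepFun_walk : iIndepFun walk (stepsLaw p) := by
  rw [iIndepFun_iff_map_fun_eq_infinitePi_map measurable_walk]
  simp_rw [map_walk]
  have h := Measure.infinitePi_map_curry (ι := ℤ × ℕ) (κ := ℕ) (fun _ _ => stepLaw p)
  unfold pathLaw
  rw [← h, ← Measure.map_infinitePi_infinitePi_of_inj (P := fun _ : ℤ × ℕ × ℕ => stepLaw p)
    (f := fun z : (ℤ × ℕ) × ℕ => (z.1.1, z.1.2, z.2))
    (by rintro ⟨⟨a, b⟩, c⟩ ⟨⟨a', b'⟩, c'⟩ h; simp_all), Measure.map_map (by fun_prop) (by fun_prop)]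
  rfl

/-- This is what permits conditioning on the first step. A cylinder is padded to a full initial
segment of coordinates, so that coordinate 0 splits off as a factor. -/
theorem map_cons_pathLaw :
    ((stepLaw p).prod (pathLaw p)).map consPath = pathLaw p := by
  refine Measure.eq_infinitePi _ fun s t ht => ?_
  classical
  obtain ⟨n, hn⟩ : ∃ n, s ⊆ Finset.range (n + 1) :=
    ⟨s.sup id, fun i hi => Finset.mem_range.2 (Nat.lt_succ_of_le (Finset.le_sup (f := id) hi))⟩
  set t' : ℕ → Set ℤ := fun i => if i ∈ s then t i else Set.univ with ht'
  have hmt' : ∀ i, MeasurableSet (t' i) := fun i => .of_discrete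
  have e1 : Set.pi (s : Set ℕ) t = Set.pi (Finset.range (n + 1) : Set ℕ) t' := by
    ext u
    simp only [Set.mem_pi, ht']
    constructor
    · intro h i _
      by_cases hi : i ∈ s
      · simpa [hi] using h i hi
      · simp [hi]
    · intro h i hi
      have := h i (hn hi)
      rwa [if_pos (Finset.mem_coe.1 hi)] at this
  have e2 : ∏ i ∈ s, stepLaw p (t i) = ∏ i ∈ Finset.range (n + 1), stepLaw p (t' i) := by
    rw [← Finset.prod_subset hn (f := fun i => stepLaw p (t' i))]
    · exact Finset.prod_congr rfl fun i hi => by simp [ht', hi]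
    · intro i _ hi
      simp [ht', hi]
  rw [e1, e2, Measure.map_apply measurable_consPath (.pi (Finset.countable_toSet _) fun i _ => hmt' i),
    Finset.prod_range_succ']
  have e3 : consPath ⁻¹'
      (Set.pi (Finset.range (n + 1) : Set ℕ) t') =
      t' 0 ×ˢ Set.pi (Finset.range n : Set ℕ) (fun i => t' (i + 1)) := by
    ext z
    simp only [Set.mem_preimage, Set.mem_pi, Finset.coe_range, Set.mem_Iio, Set.mem_prod]
    constructor
    · exact fun h => ⟨h 0 (by omega), fun i hi => h (i + 1) (by omega)⟩
    · rintro ⟨h0, h⟩ i hi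
      cases i with
      | zero => exact h0
      | succ i => exact h i (by omega)
  rw [e3, Measure.prod_prod, pathLaw, Measure.infinitePi_pi _ fun i _ => hmt' _, mul_comm]

theorem pathLaw_steps_eq_one (k : ℕ) :
    pathLaw p {u | ∀ l < k, u l = 1} = ENNReal.ofReal (1 - p) ^ k := by
  have : {u : ℕ → ℤ | ∀ l < k, u l = 1} =
      Set.pi (Finset.range k : Set ℕ) fun _ => ({1} : Set ℤ) := by
    ext u; simp [Set.mem_pi]
  rw [this, pathLaw, Measure.infinitePi_pi _ fun i _ => measurableSet_singleton _]
  simp [stepLaw]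

theorem ae_neg_one_le_steps : ∀ᵐ u ∂pathLaw p, ∀ l, -1 ≤ u l := by
  refine ae_all_iff.2 fun l => ?_
  have h : ∀ᵐ x ∂stepLaw p, -1 ≤ x := by
    rw [ae_iff]
    simp [stepLaw]
  exact (measurePreserving_eval_infinitePi (fun _ : ℕ => stepLaw p) l).quasiMeasurePreserving.ae h

/-- Gambler's ruin by induction on the horizon: `k ↦ ρ ^ k` is harmonic for the walk, p ρ ^ (k + 1)
+ (1 - p) ρ ^ (k - 1) = ρ ^ k, and for k ≤ 0 the bound is at least 1. The finite horizon makes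
first-step analysis an induction, and the level must be an integer because the first step shifts it.
-/
theorem pathLaw_exists_le_displacement_le (hp0 : 1 / 2 < p) (hp1 : p < 1) (N : ℕ) (k : ℤ) :
    pathLaw p {u | ∃ a ≤ N, k ≤ displacement u a} ≤ ENNReal.ofReal (((1 - p) / p) ^ k) := by
  have hρ0 : 0 < (1 - p) / p := by apply div_pos <;> linarith
  have hρ1 : (1 - p) / p ≤ 1 := by rw [div_le_one (by linarith)]; linarith
  have hmeas : ∀ N k, MeasurableSet {u | ∃ a ≤ N, k ≤ displacement u a} := fun N k => by
    have : {u | ∃ a ≤ N, k ≤ displacement u a} =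
        ⋃ a, ⋃ (_ : a ≤ N), (fun u => displacement u a) ⁻¹' Set.Ici k := by ext u; simp
    rw [this]
    exact .iUnion fun a => .iUnion fun _ => measurable_displacement a measurableSet_Ici
  induction N generalizing k with
  | zero =>
    by_cases hk : k ≤ 0
    · refine prob_le_one.trans ?_
      rw [← ENNReal.ofReal_one]
      exact ENNReal.ofReal_le_ofReal (one_le_zpow_of_nonpos₀ hρ0 hρ1 hk)
    · have : {u : ℕ → ℤ | ∃ a ≤ 0, k ≤ displacement u a} = ∅ := by
        ext u; simpa [displacement] using hk
      rw [this, measure_empty]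
      exact zero_le
  | succ N ih =>
    by_cases hk : k ≤ 0
    · refine prob_le_one.trans ?_
      rw [← ENNReal.ofReal_one]
      exact ENNReal.ofReal_le_ofReal (one_le_zpow_of_nonpos₀ hρ0 hρ1 hk)
    rw [← map_cons_pathLaw, Measure.map_apply measurable_consPath (hmeas _ _),
      Measure.prod_apply (measurable_consPath (hmeas _ _))]
    have hsec : ∀ x : ℤ, Prod.mk x ⁻¹' (consPath ⁻¹'
          {u | ∃ a ≤ N + 1, k ≤ displacement u a}) = {u | ∃ a ≤ N, k - x ≤ displacement u a} := by
      intro x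
      ext u
      simp only [Set.mem_preimage, Set.mem_ofPred_eq]
      constructor
      · rintro ⟨a, ha, h⟩
        cases a with
        | zero => simp [displacement] at h; omega
        | succ a =>
          rw [displacement_consPath] at h
          exact ⟨a, by omega, by linarith⟩
      · rintro ⟨a, ha, h⟩
        refine ⟨a + 1, by omega, ?_⟩
        rw [displacement_consPath]
        linarith
    simp_rw [hsec]
    simp only [stepLaw, lintegral_add_measure, lintegral_smul_measure, lintegral_dirac,
      smul_eq_mul]
    refine (add_le_add (mul_le_mul_right (ih _) _) (mul_le_mul_right (ih _) _)).trans ?_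
    have h1p : 0 ≤ 1 - p := by linarith
    have hp' : 0 ≤ p := by linarith
    rw [← ENNReal.ofReal_mul hp', ← ENNReal.ofReal_mul h1p, ← ENNReal.ofReal_add (by positivity)
      (by positivity)]
    refine ENNReal.ofReal_le_ofReal (le_of_eq ?_)
    have hp0' : p ≠ 0 := by linarith
    have hp1' : 1 - p ≠ 0 := by linarith
    rw [sub_neg_eq_add, zpow_add₀ hρ0.ne', zpow_sub₀ hρ0.ne', zpow_one]
    field_simp
    ring

theorem pathLaw_reach_le (hp0 : 1 / 2 < p) (hp1 : p < 1) (k : ℕ) :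
    pathLaw p (reach k) ≤ ENNReal.ofReal (((1 - p) / p) ^ k) := by
  have : reach k = ⋃ N, {u | ∃ a ≤ N, (k : ℤ) ≤ displacement u a} := by
    ext u
    simp only [reach, Set.mem_ofPred_eq, Set.mem_iUnion]
    exact ⟨fun ⟨a, h⟩ => ⟨a, a, le_rfl, h⟩, fun ⟨_, a, _, h⟩ => ⟨a, h⟩⟩
  have hmono : Monotone fun N : ℕ => {u : ℕ → ℤ | ∃ a ≤ N, (k : ℤ) ≤ displacement u a} :=
    fun N M hNM u ⟨a, ha, h⟩ => ⟨a, ha.trans hNM, h⟩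
  rw [this, hmono.measure_iUnion]
  refine iSup_le fun N => ?_
  simpa using pathLaw_exists_le_displacement_le hp0 hp1 N k

theorem ae_tendsto_displacement_atBot (hp0 : 1 / 2 < p) (hp1 : p < 1) :
    ∀ᵐ u ∂pathLaw p, Tendsto (displacement u) atTop atBot := by
  have hint : Integrable (fun x : ℤ => (x : ℝ)) (stepLaw p) := by
    unfold stepLaw
    exact ((integrable_dirac (by simp)).smul_measure (by simp)).add_measure
      ((integrable_dirac (by simp)).smul_measure (by simp))
  have hmean : ∫ x, (x : ℝ) ∂stepLaw p = 1 - 2 * p := by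
    unfold stepLaw
    rw [integral_add_measure ((integrable_dirac (by simp)).smul_measure (by simp))
      ((integrable_dirac (by simp)).smul_measure (by simp)), integral_smul_measure,
      integral_smul_measure, integral_dirac, integral_dirac,
      ENNReal.toReal_ofReal (by linarith), ENNReal.toReal_ofReal (by linarith)]
    simp
    linarith
  have key := ae_tendsto_average_infinitePi (stepLaw p) (f := fun x : ℤ => (x : ℝ))
    measurable_from_top hint (g := fun l : ℕ => l) Function.injective_id
  rw [hmean] at key
  filter_upwards [key] with u hu
  have h1 : Tendsto (fun n : ℕ => ((displacement u n : ℤ) : ℝ)) atTop atBot := by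
    have := hu.neg_mul_atTop (by linarith) (tendsto_natCast_atTop_atTop (R := ℝ))
    refine this.congr' ?_
    filter_upwards [eventually_gt_atTop 0] with n hn
    have : (n : ℝ) ≠ 0 := by positivity
    simp only [displacement, Int.cast_sum]
    field_simp
  exact tendsto_intCast_atBot_iff.1 h1

end

/-! ### The discounted count of frogs behind a site -/

/-- The weight `∑ₖ m (n - k) ρ ^ k` of the frogs at or to the left of `n`. -/
noncomputable def backWeight (ρ : ℝ) (m : ℤ → ℕ) (n : ℤ) : ℝ≥0∞ :=
  ∑' k : ℕ, (m (n - k) : ℝ≥0∞) * ENNReal.ofReal ρ ^ k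

theorem backWeight_add_one (ρ : ℝ) (m : ℤ → ℕ) (n : ℤ) :
    backWeight ρ m (n + 1) = m (n + 1) + ENNReal.ofReal ρ * backWeight ρ m n := by
  rw [backWeight, tsum_eq_zero_add' ENNReal.summable, backWeight, ← ENNReal.tsum_mul_left]
  congr 1
  · simp
  · refine tsum_congr fun k => ?_
    rw [pow_succ, show n + 1 - ((k + 1 : ℕ) : ℤ) = n - k by push_cast; ring]
    ring

/-- Convergent averages force log m(-n) = o(n), so m(-n) ρ ^ n is eventually below ρ ^ (n / 2). -/
theorem backWeight_zero_ne_top {ρ : ℝ} (h0 : 0 < ρ) (h1 : ρ < 1) {m : ℤ → ℕ} (hm : ∀ x, 1 ≤ m x)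
    {L : ℝ} (hL : Tendsto (fun n : ℕ =>
      (∑ i ∈ Finset.range n, Real.log (m (-(i : ℤ)))) / n) atTop (𝓝 L)) :
    backWeight ρ m 0 ≠ ∞ := by
  have hlog : Real.log ρ < 0 := Real.log_neg h0 h1
  have h2 : Tendsto (fun n : ℕ => Real.log (m (-(n : ℤ))) / n) atTop (𝓝 0) := by
    have h1' : Tendsto (fun n : ℕ => ((n : ℝ) + 1) / n) atTop (𝓝 1) := by
      have := (tendsto_const_nhds (x := (1 : ℝ))).add
        (tendsto_const_div_atTop_nhds_zero_nat (1 : ℝ))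
      rw [add_zero] at this
      refine this.congr' ?_
      filter_upwards [eventually_gt_atTop 0] with n hn
      have : (n : ℝ) ≠ 0 := by positivity
      field_simp
    -- A single term over n is the difference of two consecutive averages, once the later one is
    -- rescaled by (n + 1) / n.
    have h3 := (hL.comp (tendsto_add_atTop_nat 1)).mul h1'
    have h4 := h3.sub hL
    simp only [mul_one, sub_self] at h4
    refine h4.congr' ?_
    filter_upwards [eventually_gt_atTop 0] with n hn
    have : (n : ℝ) ≠ 0 := by positivity
    have h5 : (n : ℝ) + 1 ≠ 0 := by positivity
    simp only [Function.comp, Finset.sum_range_succ]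
    push_cast
    field_simp
    ring
  have h6 : ∀ᶠ n : ℕ in atTop, Real.log (m (-(n : ℤ))) / n < -Real.log ρ / 2 :=
    h2.eventually_lt_const (by linarith)
  have hs : Summable fun k : ℕ => (m (0 - (k : ℤ)) : ℝ) * ρ ^ k := by
    have hg : Summable fun k : ℕ => Real.exp (Real.log ρ / 2) ^ k :=
      summable_geometric_of_lt_one (Real.exp_pos _).le (by rw [Real.exp_lt_one_iff]; linarith)
    refine Summable.of_norm_bounded_eventually_nat hg ?_
    filter_upwards [h6, eventually_gt_atTop 0] with n hn hn0
    have hm0 : (0 : ℝ) < m (-(n : ℤ)) := by exact_mod_cast hm _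
    have hn' : (0 : ℝ) < n := by positivity
    rw [div_lt_iff₀ hn'] at hn
    rw [zero_sub, Real.norm_of_nonneg (by positivity), ← Real.exp_nat_mul]
    calc (m (-(n : ℤ)) : ℝ) * ρ ^ n = Real.exp (Real.log (m (-(n : ℤ))) + n * Real.log ρ) := by
          rw [Real.exp_add, Real.exp_log hm0, Real.exp_nat_mul, Real.exp_log h0]
      _ ≤ _ := Real.exp_le_exp.2 (by linarith)
  have := hs.tsum_ofReal_ne_top
  unfold backWeight
  convert this using 3 with k
  rw [ENNReal.ofReal_mul (by positivity), ENNReal.ofReal_natCast, ENNReal.ofReal_pow h0.le]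

/-- While D > 1 / (ρ c), the new term m is at most ρ D · c m, so one step multiplies D by at most ρ
(1 + c m). On average this factor has logarithm log ρ + L < 0, which would drive D to 0. -/
theorem frequently_le_of_recursion {ρ c L : ℝ} (h0 : 0 < ρ) (hc : 0 < c) (hL : L < -Real.log ρ)
    {D m : ℕ → ℝ} (hm : ∀ n, 1 ≤ m n) (hD : ∀ n, D (n + 1) = m n + ρ * D n)
    (hlim : Tendsto (fun n : ℕ => (∑ i ∈ Finset.range n, Real.log (1 + c * m i)) / n)
      atTop (𝓝 L)) :
    ∃ᶠ n in atTop, D n ≤ 1 / (ρ * c) := by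
  intro hcon
  obtain ⟨n₀, hn₀⟩ := eventually_atTop.1 hcon
  simp only [not_le] at hn₀
  have hM : 0 < 1 / (ρ * c) := by positivity
  -- log D minus its allowed growth: non-increasing as long as D stays above the threshold.
  set E : ℕ → ℝ := fun n => Real.log (D n) - n * Real.log ρ -
    ∑ i ∈ Finset.range n, Real.log (1 + c * m i) with hE
  have hstep : ∀ n ≥ n₀, E (n + 1) ≤ E n := by
    intro n hn
    have hDn : 0 < D n := hM.trans (hn₀ n hn)
    have hmn : 0 < m n := zero_lt_one.trans_le (hm n)
    have h1 : D (n + 1) ≤ ρ * D n * (1 + c * m n) := by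
      rw [hD]
      have h2 : 1 ≤ ρ * D n * c := by
        have := (hn₀ n hn).le
        rw [div_le_iff₀ (by positivity)] at this
        linarith
      nlinarith
    have hD1 : 0 < D (n + 1) := hM.trans (hn₀ _ (by omega))
    have h3 := Real.log_le_log hD1 h1
    rw [Real.log_mul (by positivity) (by positivity), Real.log_mul h0.ne' hDn.ne'] at h3
    simp only [hE, Finset.sum_range_succ]
    push_cast
    linarith
  have hbound : ∀ n ≥ n₀, E n ≤ E n₀ := by
    intro n hn
    induction n, hn using Nat.le_induction with
    | base => exact le_rfl
    | succ n hn ih => exact (hstep n hn).trans ih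
  have h4 : Tendsto (fun n : ℕ => (Real.log (1 / (ρ * c)) - E n₀) / (n : ℝ)) atTop (𝓝 0) :=
    tendsto_const_nhds.div_atTop tendsto_natCast_atTop_atTop
  -- Dividing log (1 / (ρ c)) < log (D n) by n and passing to the limit gives 0 ≤ log ρ + L, against
  -- `hL`.
  have h5 := le_of_tendsto_of_tendsto h4 (hlim.const_add (Real.log ρ)) <| by
    filter_upwards [eventually_ge_atTop n₀, eventually_gt_atTop 0] with n hn hn0
    have hn' : (0 : ℝ) < n := by positivity
    rw [div_le_iff₀ hn', add_mul, div_mul_cancel₀ _ hn'.ne']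
    have h6 := hbound n hn
    have h7 := Real.log_lt_log hM (hn₀ n hn)
    have h8 : E n = Real.log (D n) - n * Real.log ρ -
      ∑ i ∈ Finset.range n, Real.log (1 + c * m i) := rfl
    linarith
  linarith

/-! ### The random frog counts under the two moment conditions -/

theorem integrable_log_max_one {ν : Measure ℕ}
    (hν : ∫⁻ k, ENNReal.ofReal (Real.posLog (k : ℝ)) ∂ν < ⊤) :
    Integrable (fun k : ℕ => Real.log ((max 1 k : ℕ) : ℝ)) ν := by
  have : (fun k : ℕ => Real.log ((max 1 k : ℕ) : ℝ)) = fun k : ℕ => Real.posLog (k : ℝ) := by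
    ext k
    rw [Real.posLog_eq_log_max_one (by positivity)]
    simp
  rw [this]
  refine ⟨measurable_from_top.aestronglyMeasurable, ?_⟩
  rw [hasFiniteIntegral_iff_ofReal (.of_forall fun k => Real.posLog_nonneg)]
  exact hν

section

variable {ν : Measure ℕ} [IsProbabilityMeasure ν]

theorem log_one_add_mul_max_le {c : ℝ} (hc0 : 0 ≤ c) (hc1 : c ≤ 1) (k : ℕ) :
    ‖Real.log (1 + c * (max 1 k : ℕ))‖ ≤ Real.log 2 + Real.log ((max 1 k : ℕ) : ℝ) := by
  have hm : (1 : ℝ) ≤ (max 1 k : ℕ) := by exact_mod_cast le_max_left 1 k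
  have h1 : 0 ≤ c * (max 1 k : ℕ) := by positivity
  rw [Real.norm_of_nonneg (Real.log_nonneg (by linarith)), ← Real.log_mul (by norm_num)
    (by positivity)]
  refine Real.log_le_log (by linarith) ?_
  nlinarith

theorem integrable_log_one_add_mul_max
    (hν : ∫⁻ k, ENNReal.ofReal (Real.posLog (k : ℝ)) ∂ν < ⊤) {c : ℝ} (hc0 : 0 ≤ c) (hc1 : c ≤ 1) :
    Integrable (fun k : ℕ => Real.log (1 + c * (max 1 k : ℕ))) ν :=
  ((integrable_const (Real.log 2)).add (integrable_log_max_one hν)).mono'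
    measurable_from_top.aestronglyMeasurable (.of_forall (log_one_add_mul_max_le hc0 hc1))

/-- Dominated convergence as c → 0, with dominating function log 2 + log m. It makes the growth rate
in `frequently_le_of_recursion` smaller than -log ρ. -/
theorem exists_integral_log_one_add_mul_max_lt
    (hν : ∫⁻ k, ENNReal.ofReal (Real.posLog (k : ℝ)) ∂ν < ⊤) {ε : ℝ} (hε : 0 < ε) :
    ∃ c : ℝ, 0 < c ∧ c ≤ 1 ∧ ∫ k : ℕ, Real.log (1 + c * (max 1 k : ℕ)) ∂ν < ε := by
  have key : Tendsto (fun j : ℕ => ∫ k : ℕ, Real.log (1 + (1 / ((j : ℝ) + 1)) * (max 1 k : ℕ)) ∂ν)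
      atTop (𝓝 (∫ _ : ℕ, (0 : ℝ) ∂ν)) := by
    refine tendsto_integral_of_dominated_convergence
      (fun k : ℕ => Real.log 2 + Real.log ((max 1 k : ℕ) : ℝ))
      (fun j => measurable_from_top.aestronglyMeasurable)
      ((integrable_const (Real.log 2)).add (integrable_log_max_one hν)) ?_ ?_
    · exact fun j => .of_forall (log_one_add_mul_max_le (by positivity) (by
        rw [div_le_one (by positivity)]; linarith [(Nat.cast_nonneg j : (0 : ℝ) ≤ j)]))
    · refine .of_forall fun k => ?_
      have h1 : Tendsto (fun j : ℕ => 1 + (1 / ((j : ℝ) + 1)) * (max 1 k : ℕ)) atTop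
          (𝓝 (1 + 0 * (max 1 k : ℕ))) :=
        (tendsto_one_div_add_atTop_nhds_zero_nat.mul_const _).const_add 1
      have := h1.log (by simp)
      simpa using this
  rw [integral_zero] at key
  obtain ⟨j, hj⟩ := (key.eventually_lt_const hε).exists
  exact ⟨1 / ((j : ℝ) + 1), by positivity, by
    rw [div_le_one (by positivity)]; linarith [(Nat.cast_nonneg j : (0 : ℝ) ≤ j)], hj⟩

theorem ae_backWeight (hν : ∫⁻ k, ENNReal.ofReal (Real.posLog (k : ℝ)) ∂ν < ⊤) {ρ : ℝ}
    (h0 : 0 < ρ) (h1 : ρ < 1) :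
    ∀ᵐ η ∂Measure.infinitePi fun _ : ℤ => ν,
      backWeight ρ (fun x => max 1 (η x)) 0 ≠ ∞ ∧
      ∃ M : ℝ, ∃ᶠ n : ℕ in atTop, backWeight ρ (fun x => max 1 (η x)) n ≤ ENNReal.ofReal M := by
  obtain ⟨c, hc0, hc1, hc⟩ := exists_integral_log_one_add_mul_max_lt hν
    (ε := -Real.log ρ) (neg_pos.2 (Real.log_neg h0 h1))
  filter_upwards [ae_tendsto_average_infinitePi ν measurable_from_top (integrable_log_max_one hν)
      (g := fun i : ℕ => -(i : ℤ)) (fun a b h => by simpa using h),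
    ae_tendsto_average_infinitePi ν measurable_from_top
      (integrable_log_one_add_mul_max hν hc0.le hc1)
      (g := fun i : ℕ => (i : ℤ) + 1) (fun a b h => by simpa using h)] with η hη1 hη2
  have hfin : backWeight ρ (fun x => max 1 (η x)) 0 ≠ ∞ :=
    backWeight_zero_ne_top h0 h1 (fun x => le_max_left _ _) hη1
  refine ⟨hfin, 1 / (ρ * c), ?_⟩
  have hfin' : ∀ n : ℕ, backWeight ρ (fun x => max 1 (η x)) n ≠ ∞ := by
    intro n
    induction n with
    | zero => exact hfin
    | succ n ih =>
      rw [Nat.cast_succ, backWeight_add_one]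
      exact ENNReal.add_ne_top.2 ⟨ENNReal.natCast_ne_top _,
        ENNReal.mul_ne_top ENNReal.ofReal_ne_top ih⟩
  have key := frequently_le_of_recursion (L := ∫ k : ℕ, Real.log (1 + c * (max 1 k : ℕ)) ∂ν)
    (D := fun n => (backWeight ρ (fun x => max 1 (η x)) n).toReal)
    (m := fun n => ((max 1 (η ((n : ℤ) + 1)) : ℕ) : ℝ)) h0 hc0 hc
    (fun n => by exact_mod_cast le_max_left _ _) (fun n => by
      rw [Nat.cast_succ, backWeight_add_one, ENNReal.toReal_add (ENNReal.natCast_ne_top _)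
        (ENNReal.mul_ne_top ENNReal.ofReal_ne_top (hfin' n)), ENNReal.toReal_mul,
        ENNReal.toReal_ofReal h0.le, ENNReal.toReal_natCast]) hη2
  refine key.mono fun n hn => ?_
  exact (ENNReal.le_ofReal_iff_toReal_le (hfin' n) (by positivity)).2 hn

/-- Up to the factor -log q, log⁺ j is at most the number of k with j q ^ k ≥ 1. Integrating, an
infinite log-moment makes the probabilities of the independent events `B k` sum to infinity, and the
second Borel–Cantelli lemma applies. -/
theorem ae_frequently_one_le (hν : ∫⁻ k, ENNReal.ofReal (Real.posLog (k : ℝ)) ∂ν = ⊤) {q : ℝ}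
    (h0 : 0 < q) (h1 : q < 1) :
    ∀ᵐ η ∂Measure.infinitePi fun _ : ℤ => ν, ∃ᶠ k : ℕ in atTop, 1 ≤ (η (-(k : ℤ)) : ℝ) * q ^ k := by
  have hlog : Real.log q < 0 := Real.log_neg h0 h1
  set B : ℕ → Set ℕ := fun k => {j | 1 ≤ (j : ℝ) * q ^ k} with hB
  have hpt : ∀ j : ℕ, ENNReal.ofReal (Real.posLog (j : ℝ)) ≤
      ENNReal.ofReal (-Real.log q) * ∑' k, (B k).indicator (1 : ℕ → ℝ≥0∞) j := by
    intro j
    rcases Nat.eq_zero_or_pos j with rfl | hj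
    · simp
    have hj' : (1 : ℝ) ≤ j := by exact_mod_cast hj
    -- The condition j q ^ k ≥ 1 means k ≤ log j / (-log q), which holds for the `N + 1` values 0,
    -- …, N.
    set N := ⌊Real.log j / (-Real.log q)⌋₊ with hN
    have h2 : ∀ k ∈ Finset.range (N + 1), (B k).indicator (1 : ℕ → ℝ≥0∞) j = 1 := by
      intro k hk
      refine Set.indicator_of_mem (s := B k) ?_ _
      change 1 ≤ (j : ℝ) * q ^ k
      have h3 : (k : ℝ) ≤ Real.log j / (-Real.log q) := by
        refine (Nat.le_floor_iff (div_nonneg (Real.log_nonneg hj') (by linarith))).1 ?_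
        exact Nat.lt_succ_iff.1 (Finset.mem_range.1 hk)
      rw [le_div_iff₀ (by linarith)] at h3
      rw [← Real.log_nonneg_iff (by positivity), Real.log_mul (by positivity) (by positivity),
        Real.log_pow]
      linarith
    calc ENNReal.ofReal (Real.posLog (j : ℝ))
        ≤ ENNReal.ofReal (-Real.log q * ((N + 1 : ℕ) : ℝ)) := by
          refine ENNReal.ofReal_le_ofReal ?_
          rw [Real.posLog_eq_log (by rwa [Nat.abs_cast]), mul_comm, ← div_le_iff₀ (by linarith)]
          push_cast
          exact (Nat.lt_floor_add_one _).le
      _ = ENNReal.ofReal (-Real.log q) * ∑ k ∈ Finset.range (N + 1), (B k).indicator (1 : ℕ → ℝ≥0∞) j := by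
          rw [ENNReal.ofReal_mul (by linarith), Finset.sum_congr rfl h2, ENNReal.ofReal_natCast]
          simp
      _ ≤ _ := by gcongr; exact ENNReal.sum_le_tsum _
  have hsum : ∑' k, ν (B k) = ∞ := by
    by_contra hne
    have h3 := lintegral_mono hpt (μ := ν)
    rw [hν, lintegral_const_mul _ measurable_from_top,
      lintegral_tsum fun k => measurable_from_top.aemeasurable] at h3
    simp_rw [lintegral_indicator_one (MeasurableSet.of_discrete (s := B _))] at h3
    exact ENNReal.mul_ne_top ENNReal.ofReal_ne_top hne (top_le_iff.1 h3)
  have hind : iIndepSet (fun k : ℕ => (fun η : ℤ → ℕ => η (-(k : ℤ))) ⁻¹' B k)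
      (Measure.infinitePi fun _ : ℤ => ν) :=
    iIndepSet_preimage (X := fun (k : ℕ) (η : ℤ → ℕ) => η (-(k : ℤ)))
      ((iIndepFun_infinitePi (P := fun _ : ℤ => ν) (X := fun _ x => x)
        fun _ => measurable_id).precomp (g := fun k : ℕ => -(k : ℤ)) fun a b h => by simpa using h)
      (fun k => measurable_pi_apply _) fun k => .of_discrete
  have hmeas : ∀ k : ℕ, MeasurableSet ((fun η : ℤ → ℕ => η (-(k : ℤ))) ⁻¹' B k) :=
    fun k => measurable_pi_apply _ .of_discrete
  have key := measure_limsup_eq_one hmeas hind (by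
    rw [← hsum]
    refine tsum_congr fun k => ?_
    exact (measurePreserving_eval_infinitePi (fun _ : ℤ => ν) (-(k : ℤ))).measure_preimage
      MeasurableSet.of_discrete.nullMeasurableSet)
  rw [← prob_compl_eq_zero_iff (MeasurableSet.measurableSet_limsup hmeas)] at key
  refine measure_mono_null (fun η hη => ?_) key
  rw [Set.mem_compl_iff, mem_limsup_iff_frequently_mem]
  exact hη

end

/-! ### The walks of all frogs for fixed frog counts -/

theorem iIndepSet_biInter_preimage {ι κ Ω : Type*} {β : ι → Type*} [MeasurableSpace Ω]
    [∀ i, MeasurableSpace (β i)] {μ : Measure Ω} {X : ∀ i, Ω → β i} (hX : iIndepFun X μ)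
    (hm : ∀ i, Measurable (X i)) {S : κ → Finset ι} (hS : Pairwise (Function.onFun Disjoint S))
    {B : κ → ∀ i, Set (β i)} (hB : ∀ j i, MeasurableSet (B j i)) :
    iIndepSet (fun j => ⋂ i ∈ S j, X i ⁻¹' B j i) μ := by
  have hinj : Function.Injective fun z : (j : κ) × S j => (z.2 : ι) := by
    rintro ⟨j, i, hi⟩ ⟨j', i', hi'⟩ h
    obtain rfl : i = i' := h
    obtain rfl : j = j' := by
      by_contra hne
      exact Finset.disjoint_left.1 (hS hne) hi hi'
    rfl
  have hX' := hX.precomp hinj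
  refine (iIndepSet_iff_meas_biInter fun j => ?_).2 fun T => ?_
  · exact Finset.measurableSet_biInter _ fun i _ => hm i (hB j i)
  have h1 := hX'.measure_inter_preimage_eq_mul (T.sigma fun j => (S j).attach)
    (sets := fun z => B z.1 z.2) fun z _ => hB _ _
  rw [Finset.prod_sigma] at h1
  have h2 : (⋂ j ∈ T, ⋂ i ∈ S j, X i ⁻¹' B j i) =
      ⋂ z ∈ T.sigma fun j => (S j).attach, X (z.2 : ι) ⁻¹' B z.1 z.2 := by
    ext ω
    simp only [Set.mem_iInter, Finset.mem_sigma, Finset.mem_attach, and_true]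
    exact ⟨fun h z hz => h z.1 hz z.2 z.2.2, fun h j hj i hi => h ⟨j, i, hi⟩ hj⟩
  rw [h2]
  refine h1.trans (Finset.prod_congr rfl fun j _ => ?_)
  rw [hX.measure_inter_preimage_eq_mul (S j) fun i _ => hB j i,
    ← Finset.prod_attach (S j)]

section

variable {p : ℝ} [hP : IsProbabilityMeasure (stepLaw p)]

theorem stepsLaw_walk_preimage {B : Set (ℕ → ℤ)} (hB : MeasurableSet B) (z : ℤ × ℕ) :
    stepsLaw p (walk z ⁻¹' B) = pathLaw p B := by
  rw [← map_walk z, Measure.map_apply (measurable_walk z) hB]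

theorem tsum_lt_mul_const (f : ℕ → ℕ) (g : ℕ → ℝ≥0∞) :
    ∑' z : ℕ × ℕ, (if z.2 < f z.1 then g z.1 else 0) = ∑' k, (f k : ℝ≥0∞) * g k := by
  rw [ENNReal.tsum_prod (f := fun k i => if i < f k then g k else 0)]
  refine tsum_congr fun k => ?_
  rw [tsum_eq_sum (s := Finset.range (f k)) fun i hi => if_neg (by simpa using hi),
    Finset.sum_congr rfl fun i hi => if_pos (Finset.mem_range.1 hi)]
  simp

theorem measurableSet_firstSteps (k : ℕ) : MeasurableSet {u : ℕ → ℤ | ∀ l < k, u l = 1} := by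
  have : {u : ℕ → ℤ | ∀ l < k, u l = 1} = ⋂ l, ⋂ (_ : l < k), (fun u => u l) ⁻¹' {1} := by
    ext u; simp
  rw [this]
  exact .iInter fun l => .iInter fun _ => measurable_pi_apply l .of_discrete

/-- Each of the m(-k) frogs at -k makes k right steps at once with probability (1 - p) ^ k. The
total of these probabilities diverges, since infinitely many sites contribute at least 1. -/
theorem ae_frequently_straight {m : ℤ → ℕ} (hp1 : p < 1)
    (hm : ∃ᶠ k : ℕ in atTop, 1 ≤ (m (-(k : ℤ)) : ℝ) * (1 - p) ^ k) :
    ∀ᵐ s ∂stepsLaw p, ∃ᶠ k : ℕ in atTop,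
      ∃ i < m (-(k : ℤ)), ∀ l < k, walk (-(k : ℤ), i) s l = 1 := by
  -- The labels (k, i) are enumerated by `Nat.unpair`; labels of nonexistent frogs get the empty
  -- event.
  set B : ℕ → Set (ℕ → ℤ) := fun n =>
    if n.unpair.2 < m (-(n.unpair.1 : ℤ)) then {u | ∀ l < n.unpair.1, u l = 1} else ∅ with hB
  set Z : ℕ → ℤ × ℕ := fun n => (-(n.unpair.1 : ℤ), n.unpair.2) with hZ
  have hZinj : Function.Injective Z := fun a b h => by
    simp only [hZ, Prod.mk.injEq, neg_inj, Nat.cast_inj] at h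
    rw [← Nat.pair_unpair a, ← Nat.pair_unpair b, h.1, h.2]
  have hBm : ∀ n, MeasurableSet (B n) := fun n => by
    simp only [hB]
    split_ifs
    exacts [measurableSet_firstSteps _, .empty]
  have hind := iIndepSet_preimage (iIndepFun_walk (p := p) |>.precomp hZinj)
    (fun n => measurable_walk (Z n)) hBm
  have hmeas : ∀ n, MeasurableSet (walk (Z n) ⁻¹' B n) := fun n => measurable_walk _ (hBm n)
  have hsum : ∑' n, stepsLaw p (walk (Z n) ⁻¹' B n) = ∞ := by
    have h1 : ∀ n, stepsLaw p (walk (Z n) ⁻¹' B n) =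
        (fun z : ℕ × ℕ => if z.2 < m (-(z.1 : ℤ)) then ENNReal.ofReal (1 - p) ^ z.1 else 0)
          (Nat.pairEquiv.symm n) := by
      intro n
      rw [stepsLaw_walk_preimage (hBm n)]
      simp only [hB, Nat.pairEquiv_symm_apply]
      split_ifs
      exacts [pathLaw_steps_eq_one _, measure_empty]
    rw [tsum_congr h1, Nat.pairEquiv.symm.tsum_eq
      (fun z : ℕ × ℕ => if z.2 < m (-(z.1 : ℤ)) then ENNReal.ofReal (1 - p) ^ z.1 else 0),
      tsum_lt_mul_const (fun k => m (-(k : ℤ))) fun k => ENNReal.ofReal (1 - p) ^ k]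
    by_contra hne
    have h2 := ENNReal.tendsto_atTop_zero_of_tsum_ne_top hne
    refine hm ((h2.eventually_lt_const zero_lt_one).mono fun k hk hk' => ?_)
    refine hk.not_ge ?_
    rw [← ENNReal.ofReal_natCast, ← ENNReal.ofReal_pow (by linarith),
      ← ENNReal.ofReal_mul (by positivity), ← ENNReal.ofReal_one]
    exact ENNReal.ofReal_le_ofReal hk'
  have key := measure_limsup_eq_one hmeas hind hsum
  rw [← prob_compl_eq_zero_iff (MeasurableSet.measurableSet_limsup hmeas)] at key
  have key' : ∀ᵐ s ∂stepsLaw p, s ∈ limsup (fun n => walk (Z n) ⁻¹' B n) atTop := key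
  filter_upwards [key'] with s hs
  rw [mem_limsup_iff_frequently_mem] at hs
  have hmem : ∀ n, s ∈ walk (Z n) ⁻¹' B n → n.unpair.2 < m (-(n.unpair.1 : ℤ)) ∧
      ∀ l < n.unpair.1, walk (-(n.unpair.1 : ℤ), n.unpair.2) s l = 1 := by
    intro n hn
    simp only [hB, Set.mem_preimage] at hn
    split_ifs at hn with h
    · exact ⟨h, hn⟩
    · exact hn.elim
  intro hcon
  obtain ⟨K, hK⟩ := eventually_atTop.1 hcon
  -- Each site holds finitely many frogs, so infinitely many successful frogs occupy infinitely many
  -- sites.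
  refine (Nat.frequently_atTop_iff_infinite.1 hs) (Set.Finite.subset
    (((Finset.range K).sigma fun k => Finset.range (m (-(k : ℤ)))).image
      fun z => Nat.pair z.1 z.2).finite_toSet fun n hn => ?_)
  obtain ⟨h1, h2⟩ := hmem n hn
  simp only [Finset.coe_image, Set.mem_image, Finset.mem_coe, Finset.mem_sigma, Finset.mem_range]
  refine ⟨⟨n.unpair.1, n.unpair.2⟩, ⟨?_, h1⟩, Nat.pair_unpair n⟩
  by_contra hlt
  exact hK _ (not_lt.1 hlt) ⟨_, h1, h2⟩

variable {m : ℤ → ℕ}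

theorem tsum_measure_reach_le (hp0 : 1 / 2 < p) (hp1 : p < 1) (n : ℤ) (N : ℕ) :
    ∑' z : ℕ × ℕ, stepsLaw p {s | z.2 < m (n - z.1) ∧
      walk (n - z.1, z.2) s ∈ reach ((N + z.1 : ℕ) : ℤ)} ≤
      ENNReal.ofReal ((1 - p) / p) ^ N * backWeight ((1 - p) / p) m n := by
  have hρ0 : 0 < (1 - p) / p := by apply div_pos <;> linarith
  calc _ ≤ ∑' z : ℕ × ℕ, (if z.2 < m (n - z.1) then
        ENNReal.ofReal ((1 - p) / p) ^ (N + z.1) else 0) := by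
        refine ENNReal.tsum_le_tsum fun z => ?_
        split_ifs with h
        · simp only [h, true_and]
          refine (stepsLaw_walk_preimage (measurableSet_reach _) _).trans_le ?_
          rw [← ENNReal.ofReal_pow hρ0.le]
          exact pathLaw_reach_le hp0 hp1 _
        · simp [h]
    _ = _ := by
        rw [tsum_lt_mul_const (fun k => m (n - k))
          fun k => ENNReal.ofReal ((1 - p) / p) ^ (N + k), backWeight, ← ENNReal.tsum_mul_left]
        refine tsum_congr fun k => ?_
        rw [pow_add]
        ring

theorem ae_finite_reach (hp0 : 1 / 2 < p) (hp1 : p < 1)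
    (hm : backWeight ((1 - p) / p) m 0 ≠ ∞) :
    ∀ᵐ s ∂stepsLaw p, {z : ℕ × ℕ | z.2 < m (-(z.1 : ℤ)) ∧
      walk (-(z.1 : ℤ), z.2) s ∈ reach (z.1 : ℤ)}.Finite := by
  have h := tsum_measure_reach_le (m := m) hp0 hp1 0 0
  simp only [zero_sub, zero_add, pow_zero, one_mul] at h
  exact ae_finite_setOfPred_mem (ne_top_of_le_ne_top hm h)

/-- With x = ρ ^ (k + 1) ≤ ρ, 1 / (1 - x) = 1 + x / (1 - x) ≤ exp (x / (1 - ρ)). An exponent linear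
in x turns the product over frogs into the sum defining `backWeight`. -/
theorem ofReal_exp_le_pathLaw_compl_reach (hp0 : 1 / 2 < p) (hp1 : p < 1) (k : ℕ) :
    ENNReal.ofReal (Real.exp (-(((1 - p) / p) ^ (k + 1) / (1 - (1 - p) / p)))) ≤
      pathLaw p (reach ((k + 1 : ℕ) : ℤ))ᶜ := by
  have hρ0 : 0 < (1 - p) / p := by apply div_pos <;> linarith
  have hρ1 : (1 - p) / p < 1 := by rw [div_lt_one (by linarith)]; linarith
  rw [prob_compl_eq_one_sub (measurableSet_reach _)]
  refine le_trans ?_ (tsub_le_tsub_left (pathLaw_reach_le hp0 hp1 (k + 1)) 1)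
  generalize (1 - p) / p = ρ at hρ0 hρ1 ⊢
  rw [← ENNReal.ofReal_one, ← ENNReal.ofReal_sub _ (by positivity)]
  refine ENNReal.ofReal_le_ofReal ?_
  have h1 : ρ ^ (k + 1) ≤ ρ := pow_le_of_le_one hρ0.le hρ1.le (by omega)
  have h2 : 0 < ρ ^ (k + 1) := by positivity
  have h3 : 0 < 1 - ρ ^ (k + 1) := by linarith
  have h4 := Real.add_one_le_exp (ρ ^ (k + 1) / (1 - ρ))
  have h5 : 1 / (1 - ρ ^ (k + 1)) ≤ ρ ^ (k + 1) / (1 - ρ) + 1 := by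
    have h6 : ρ ^ (k + 1) / (1 - ρ ^ (k + 1)) ≤ ρ ^ (k + 1) / (1 - ρ) :=
      div_le_div_of_nonneg_left h2.le (by linarith) (by linarith)
    have h7 : 1 / (1 - ρ ^ (k + 1)) = ρ ^ (k + 1) / (1 - ρ ^ (k + 1)) + 1 := by
      field_simp
      ring
    linarith
  rw [Real.exp_neg, inv_le_comm₀ (Real.exp_pos _) h3, ← one_div]
  exact h5.trans h4

theorem sub_embedding_injective (b : ℤ) :
    Function.Injective fun z : (_ : ℕ) × ℕ => (b - (z.1 : ℤ), z.2) := by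
  rintro ⟨k, i⟩ ⟨k', i'⟩ h
  simp only [Prod.mk.injEq, sub_right_inj, Nat.cast_inj] at h
  obtain ⟨rfl, rfl⟩ := h
  rfl

/-- The frogs at the `d` sites `b, b - 1, …, b - d + 1`. -/
def blockFrogs (m : ℤ → ℕ) (b : ℤ) (d : ℕ) : Finset (ℤ × ℕ) :=
  ((Finset.range d).sigma fun k => Finset.range (m (b - k))).map
    ⟨fun z => (b - (z.1 : ℤ), z.2), sub_embedding_injective b⟩

theorem mem_blockFrogs {b : ℤ} {d : ℕ} {z : ℤ × ℕ} :
    z ∈ blockFrogs m b d ↔ b - d < z.1 ∧ z.1 ≤ b ∧ z.2 < m z.1 := by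
  simp only [blockFrogs, Finset.mem_map, Finset.mem_sigma, Finset.mem_range,
    Function.Embedding.coeFn_mk]
  constructor
  · rintro ⟨⟨k, i⟩, ⟨hk, hi⟩, rfl⟩
    exact ⟨by simp; omega, by simp, hi⟩
  · rintro ⟨h1, h2, h3⟩
    have : b - ((b - z.1).toNat : ℤ) = z.1 := by omega
    exact ⟨⟨(b - z.1).toNat, z.2⟩, ⟨by simp; omega, by simpa only [this] using h3⟩,
      by simp only [this]⟩

/-- The bound depends on M but not on the block length `d`, so it serves infinitely many blocks at
once. -/
theorem le_stepsLaw_block (hp0 : 1 / 2 < p) (hp1 : p < 1) {M : ℝ} {b : ℤ} (d : ℕ)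
    (hb : backWeight ((1 - p) / p) m b ≤ ENNReal.ofReal M) :
    ENNReal.ofReal (Real.exp (-((1 - p) / p * max M 0 / (1 - (1 - p) / p)))) ≤
      stepsLaw p (⋂ z ∈ blockFrogs m b d, walk z ⁻¹' (reach (b + 1 - z.1))ᶜ) := by
  have hρ0 : 0 < (1 - p) / p := by apply div_pos <;> linarith
  have hρ1 : (1 - p) / p < 1 := by rw [div_lt_one (by linarith)]; linarith
  rw [iIndepFun_walk.measure_inter_preimage_eq_mul _
    fun z _ => (measurableSet_reach _).compl]
  simp_rw [stepsLaw_walk_preimage (measurableSet_reach _).compl]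
  rw [blockFrogs, Finset.prod_map, Finset.prod_sigma]
  calc _ ≤ ∏ k ∈ Finset.range d, ∏ _i ∈ Finset.range (m (b - k)),
        ENNReal.ofReal (Real.exp (-(((1 - p) / p) ^ (k + 1) / (1 - (1 - p) / p)))) := ?_
    _ ≤ _ := by
        refine Finset.prod_le_prod' fun k _ => Finset.prod_le_prod' fun i _ => ?_
        have : b + 1 - (b - (k : ℤ)) = ((k + 1 : ℕ) : ℤ) := by push_cast; ring
        simp only [Function.Embedding.coeFn_mk, this]
        exact ofReal_exp_le_pathLaw_compl_reach hp0 hp1 k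
  generalize (1 - p) / p = ρ at hρ0 hρ1 hb ⊢
  simp only [Finset.prod_const, Finset.card_range]
  simp_rw [← ENNReal.ofReal_pow (Real.exp_pos _).le, ← Real.exp_nat_mul]
  rw [← ENNReal.ofReal_prod_of_nonneg fun _ _ => (Real.exp_pos _).le, ← Real.exp_sum]
  refine ENNReal.ofReal_le_ofReal (Real.exp_le_exp.2 ?_)
  have h1 : ∑ k ∈ Finset.range d, (m (b - k) : ℝ) * ρ ^ k ≤ max M 0 := by
    have h2 := (ENNReal.sum_le_tsum (f := fun k : ℕ => (m (b - k) : ℝ≥0∞) * ENNReal.ofReal ρ ^ k)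
      (Finset.range d)).trans hb
    have h3 : ∑ k ∈ Finset.range d, (m (b - k) : ℝ≥0∞) * ENNReal.ofReal ρ ^ k =
        ENNReal.ofReal (∑ k ∈ Finset.range d, (m (b - k) : ℝ) * ρ ^ k) := by
      rw [ENNReal.ofReal_sum_of_nonneg fun _ _ => by positivity]
      refine Finset.sum_congr rfl fun k _ => ?_
      rw [ENNReal.ofReal_mul (by positivity), ENNReal.ofReal_natCast, ENNReal.ofReal_pow hρ0.le]
    rw [h3] at h2
    exact (ENNReal.ofReal_le_ofReal_iff (le_max_right _ _)).1
      (h2.trans (ENNReal.ofReal_le_ofReal (le_max_left _ _)))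
  have h4 : ∑ k ∈ Finset.range d, (m (b - k) : ℝ) * -(ρ ^ (k + 1) / (1 - ρ)) =
      -(ρ * (∑ k ∈ Finset.range d, (m (b - k) : ℝ) * ρ ^ k) / (1 - ρ)) := by
    rw [Finset.mul_sum, Finset.sum_div, ← Finset.sum_neg_distrib]
    refine Finset.sum_congr rfl fun k _ => ?_
    rw [pow_succ]
    ring
  rw [h4]
  have : 0 < 1 - ρ := by linarith
  gcongr

/-- The events that no frog in (φ j, φ (j + 1)] passes φ (j + 1) are independent with probabilities
bounded below, so infinitely many occur. The frogs at or behind φ j pass φ (j + 1) for only finitely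
many j. Any late j that is good in both senses gives a barrier. -/
theorem ae_exists_barrier (hp0 : 1 / 2 < p) (hp1 : p < 1) {M : ℝ}
    (hM : ∃ᶠ n : ℕ in atTop, backWeight ((1 - p) / p) m n ≤ ENNReal.ofReal M) :
    ∀ᵐ s ∂stepsLaw p, ∃ n : ℕ, ∀ x ≤ (n : ℤ), ∀ i < m x, walk (x, i) s ∉ reach (n + 1 - x) := by
  have hρ0 : 0 < (1 - p) / p := by apply div_pos <;> linarith
  have hρ1 : (1 - p) / p < 1 := by rw [div_lt_one (by linarith)]; linarith
  obtain ⟨ψ, hψ, hψM⟩ := extraction_of_frequently_atTop hM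
  -- Sampling at squares makes the gaps grow, φ (j + 1) - φ j ≥ j, so the crossing probabilities of
  -- the far frogs are summable.
  set φ : ℕ → ℕ := fun j => ψ (j * j) with hφ
  have hφM : ∀ j, backWeight ((1 - p) / p) m (φ j) ≤ ENNReal.ofReal M := fun j => hψM _
  have hgap : ∀ j, φ j + j ≤ φ (j + 1) := fun j => by
    have h1 := hψ.add_le_nat (2 * j + 1) (j * j)
    have h2 : 2 * j + 1 + j * j = (j + 1) * (j + 1) := by ring
    rw [h2] at h1
    simp only [hφ]
    omega
  have hφmono : Monotone φ := monotone_nat_of_le_succ fun j => (Nat.le_add_right _ _).trans (hgap j)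
  set d : ℕ → ℕ := fun j => φ (j + 1) - φ j with hd
  set S : ℕ → Finset (ℤ × ℕ) := fun j => blockFrogs m (φ (j + 1)) (d j) with hS
  have hmemS : ∀ j z, z ∈ S j ↔ (φ j : ℤ) < z.1 ∧ z.1 ≤ φ (j + 1) ∧ z.2 < m z.1 := by
    intro j z
    have := hgap j
    rw [hS, mem_blockFrogs, show ((φ (j + 1) : ℕ) : ℤ) - (d j : ℕ) = φ j by simp only [hd]; omega]
  have hdisj : Pairwise (Function.onFun Disjoint S) := by
    have : ∀ i j, i < j → Disjoint (S i) (S j) := fun i j hij => by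
      rw [Finset.disjoint_left]
      intro z hz hz'
      rw [hmemS] at hz hz'
      have := hφmono (Nat.succ_le_of_lt hij)
      simp only [Nat.succ_eq_add_one] at this
      omega
    intro i j hij
    rcases lt_or_gt_of_ne hij with h | h
    exacts [this i j h, (this j i h).symm]
  set E : ℕ → Set (ℤ × ℕ × ℕ → ℤ) := fun j =>
    ⋂ z ∈ S j, walk z ⁻¹' (reach (φ (j + 1) + 1 - z.1))ᶜ with hE
  have hEm : ∀ j, MeasurableSet (E j) := fun j =>
    .iInter fun z => .iInter fun _ => measurable_walk z (measurableSet_reach _).compl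
  have hindep : iIndepSet E (stepsLaw p) :=
    iIndepSet_biInter_preimage iIndepFun_walk measurable_walk hdisj
      fun j z => (measurableSet_reach _).compl
  have hlocal := measure_limsup_eq_one hEm hindep <|
    top_le_iff.1 <| (ENNReal.tsum_const_eq_top_of_ne_zero (α := ℕ)
      (ENNReal.ofReal_pos.2 (Real.exp_pos _)).ne').symm.trans_le <| ENNReal.tsum_le_tsum
        fun j => le_stepsLaw_block hp0 hp1 (d j) (hφM (j + 1))
  rw [← prob_compl_eq_zero_iff (MeasurableSet.measurableSet_limsup hEm)] at hlocal
  have hlocal' : ∀ᵐ s ∂stepsLaw p, s ∈ limsup E atTop := hlocal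
  -- A frog `z.1` sites behind φ j must climb `z.1`, then the whole block `d j`, then one more
  -- level.
  set F : ℕ → Set (ℤ × ℕ × ℕ → ℤ) := fun j => ⋃ z : ℕ × ℕ, {s | z.2 < m (φ j - z.1) ∧
      walk (φ j - z.1, z.2) s ∈ reach ((d j + 1 + z.1 : ℕ) : ℤ)} with hF
  have hfar : ∀ᵐ s ∂stepsLaw p, ∀ᶠ j in atTop, s ∉ F j := by
    refine ae_eventually_notMem (ne_top_of_le_ne_top (b := ∑' j : ℕ,
      ENNReal.ofReal ((1 - p) / p) ^ j * ENNReal.ofReal M) ?_ (ENNReal.tsum_le_tsum fun j => ?_))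
    · rw [ENNReal.tsum_mul_right, ENNReal.tsum_geometric]
      refine ENNReal.mul_ne_top (ENNReal.inv_ne_top.2 (tsub_pos_of_lt ?_).ne') ENNReal.ofReal_ne_top
      rw [← ENNReal.ofReal_one]
      exact (ENNReal.ofReal_lt_ofReal_iff zero_lt_one).2 hρ1
    · refine (measure_iUnion_le _).trans ((tsum_measure_reach_le hp0 hp1 (φ j) (d j + 1)).trans ?_)
      refine mul_le_mul' (pow_le_pow_right_of_le_one' ?_ ?_) (hφM j)
      · rw [← ENNReal.ofReal_one]
        exact ENNReal.ofReal_le_ofReal hρ1.le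
      · have := hgap j
        simp only [hd]
        omega
  filter_upwards [hlocal', hfar] with s hs hs'
  rw [mem_limsup_iff_frequently_mem] at hs
  obtain ⟨j, hj, hj'⟩ := (hs.and_eventually hs').exists
  refine ⟨φ (j + 1), fun x hx i hi hreach => ?_⟩
  by_cases hxj : (φ j : ℤ) < x
  · have h1 := (hmemS j (x, i)).2 ⟨hxj, hx, hi⟩
    exact Set.mem_iInter₂.1 hj (x, i) h1 hreach
  · refine hj' (Set.mem_iUnion.2 ⟨((φ j - x).toNat, i), ?_⟩)
    have h2 : (φ j : ℤ) - ((φ j - x).toNat : ℤ) = x := by omega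
    have h3 : ((d j + 1 + (φ j - x).toNat : ℕ) : ℤ) = φ (j + 1) + 1 - x := by
      have := hgap j
      simp only [hd]
      omega
    simp only [Set.mem_ofPred_eq, h2, h3]
    exact ⟨hi, hreach⟩

end

/-! ### Deterministic consequences for the frog dynamics -/

theorem position_eq (ω : Sample) (x : ℤ) (i a : ℕ) :
    position ω x i a = x + displacement (walk (x, i) ω.2) a := rfl

theorem age_zero_origin (ω : Sample) : age ω 0 0 = some 0 := by simp [age]

theorem age_succ_of_some {ω : Sample} {n a : ℕ} {x : ℤ} (h : age ω n x = some a) :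
    age ω (n + 1) x = some (a + 1) := by
  simp only [age, h]

theorem age_add_of_some {ω : Sample} {n a : ℕ} {x : ℤ} (h : age ω n x = some a) (k : ℕ) :
    age ω (n + k) x = some (a + k) := by
  induction k with
  | zero => exact h
  | succ k ih => exact age_succ_of_some ih

/-- Some active frog lands on `x` at time `n + 1`. -/
def Lands (ω : Sample) (n : ℕ) (x : ℤ) : Prop :=
  ∃ y a i, age ω n y = some a ∧ i < frogs ω y ∧ position ω y i (a + 1) = x

theorem age_succ_of_lands {ω : Sample} {n : ℕ} {x : ℤ} (h : age ω n x = none)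
    (hl : Lands ω n x) : age ω (n + 1) x = some 0 := by
  simp only [age, h]
  exact if_pos hl

theorem age_succ_of_not_lands {ω : Sample} {n : ℕ} {x : ℤ} (h : age ω n x = none)
    (hl : ¬ Lands ω n x) : age ω (n + 1) x = none := by
  simp only [age, h]
  exact if_neg hl

theorem age_succ_eq_none_iff {ω : Sample} {n : ℕ} {x : ℤ} :
    age ω (n + 1) x = none ↔ age ω n x = none ∧ ¬ Lands ω n x := by
  cases h : age ω n x with
  | some a => simp [age_succ_of_some h]
  | none =>
    by_cases hl : Lands ω n x
    · simp [age_succ_of_lands h hl, hl]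
    · simp [age_succ_of_not_lands h hl, hl]

theorem age_succ_eq_some_iff {ω : Sample} {n b : ℕ} {x : ℤ} :
    age ω (n + 1) x = some b ↔
      (∃ a, age ω n x = some a ∧ a + 1 = b) ∨ age ω n x = none ∧ Lands ω n x ∧ 0 = b := by
  cases h : age ω n x with
  | some a => simp [age_succ_of_some h]
  | none =>
    by_cases hl : Lands ω n x
    · simp [age_succ_of_lands h hl, hl]
    · simp [age_succ_of_not_lands h hl, hl]

theorem exists_age_eq_zero {ω : Sample} {n b : ℕ} {x : ℤ} (h : age ω n x = some b) :
    ∃ t, age ω t x = some 0 := by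
  induction n generalizing b with
  | zero =>
    by_cases hx : x = 0
    · exact ⟨0, by simp [age, hx]⟩
    · simp [age, hx] at h
  | succ n ih =>
    rcases age_succ_eq_some_iff.1 h with ⟨a, ha, _⟩ | ⟨_, _, rfl⟩
    exacts [ih ha, ⟨_, h⟩]

theorem exists_age_of_lands {ω : Sample} {n : ℕ} {x : ℤ} (h : Lands ω n x) :
    ∃ t, age ω t x = some 0 := by
  cases hx : age ω n x with
  | none => exact ⟨_, age_succ_of_lands hx h⟩
  | some a => exact exists_age_eq_zero hx

theorem subsingleton_setOf_age_eq (ω : Sample) (x : ℤ) (a : ℕ) :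
    {n | age ω n x = some a}.Subsingleton := by
  have : ∀ n n', n < n' → age ω n x = some a → age ω n' x ≠ some a := by
    intro n n' hlt h h'
    have h1 := age_add_of_some h (n' - n)
    rw [Nat.add_sub_cancel' hlt.le, h', Option.some_inj] at h1
    omega
  intro n hn n' hn'
  rcases lt_trichotomy n n' with h | h | h
  exacts [(this n n' h hn hn').elim, h, (this n' n h hn' hn).elim]

/-- The maximum with 1 accounts for the lone frog at the origin, and it makes the logarithm of the
count equal to log⁺ η. -/
theorem frogs_le (ω : Sample) (x : ℤ) : frogs ω x ≤ max 1 (ω.1 x) := by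
  unfold frogs
  split_ifs <;> omega

/-- To wake a first site beyond n, a frog from a site ≤ n would have to cross the barrier. -/
theorem le_of_age_eq_some {ω : Sample} {n : ℕ}
    (hn : ∀ x ≤ (n : ℤ), ∀ i < max 1 (ω.1 x), walk (x, i) ω.2 ∉ reach (n + 1 - x))
    {t a : ℕ} {x : ℤ} (h : age ω t x = some a) : x ≤ n := by
  induction t generalizing x a with
  | zero =>
    by_cases hx : x = 0
    · omega
    · simp [age, hx] at h
  | succ t ih =>
    rcases age_succ_eq_some_iff.1 h with ⟨a, ha, _⟩ | ⟨_, ⟨y, a, i, hy, hi, hpos⟩, _⟩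
    · exact ih ha
    · by_contra hlt
      refine hn y (ih hy) i (hi.trans_le (frogs_le ω y)) ⟨a + 1, ?_⟩
      rw [position_eq] at hpos
      omega

theorem notMem_originVisitedIO {ω : Sample}
    (hleft : {z : ℕ × ℕ | z.2 < max 1 (ω.1 (-(z.1 : ℤ))) ∧
      walk (-(z.1 : ℤ), z.2) ω.2 ∈ reach (z.1 : ℤ)}.Finite)
    (hright : ∃ n : ℕ, ∀ x ≤ (n : ℤ), ∀ i < max 1 (ω.1 x), walk (x, i) ω.2 ∉ reach (n + 1 - x))
    (hdrift : ∀ z, Tendsto (displacement (walk z ω.2)) atTop atBot) :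
    ω ∉ originVisitedIO := by
  obtain ⟨n, hn⟩ := hright
  set Z : Set (ℤ × ℕ) :=
    {z | z.1 ≤ n ∧ z.2 < max 1 (ω.1 z.1) ∧ ∃ a, position ω z.1 z.2 a = 0} with hZ
  have hZfin : Z.Finite := by
    refine ((hleft.image fun z => (-(z.1 : ℤ), z.2)).union
      ((Finset.Ioc 0 (n : ℤ)).biUnion fun x =>
        (Finset.range (max 1 (ω.1 x))).image fun i => (x, i)).finite_toSet).subset ?_
    rintro ⟨x, i⟩ ⟨hx, hi, a, ha⟩
    dsimp only at hx hi ha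
    rcases le_or_gt x 0 with hx0 | hx0
    · have hxx : -((-x).toNat : ℤ) = x := by omega
      refine .inl ⟨((-x).toNat, i), ⟨?_, ?_⟩, ?_⟩
      · simpa only [hxx] using hi
      · simp only [hxx]
        refine ⟨a, ?_⟩
        rw [position_eq] at ha
        omega
      · simp only [hxx]
    · refine .inr ?_
      simp only [Finset.coe_biUnion, Set.mem_iUnion, Finset.mem_coe, Finset.mem_Ioc,
        Finset.mem_image, Finset.mem_range]
      exact ⟨x, ⟨hx0, hx⟩, i, hi, rfl⟩
  have hA : ∀ z : ℤ × ℕ, {a | position ω z.1 z.2 a = 0}.Finite := by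
    intro z
    obtain ⟨K, hK⟩ := eventually_atTop.1 ((hdrift z).eventually_lt_atBot (-z.1))
    refine (Set.finite_lt_nat K).subset fun a ha => ?_
    by_contra hlt
    have h1 := hK a (not_lt.1 hlt)
    have h2 : z.1 + displacement (walk z ω.2) a = 0 := ha
    omega
  -- A visit time is determined by the visiting frog and its age, since the age of a site takes each
  -- value at most once.
  have hfin : {t | OriginVisitedAt ω t}.Finite := by
    refine (hZfin.biUnion fun z _ => (hA z).biUnion fun a _ =>
      (subsingleton_setOf_age_eq ω z.1 a).finite).subset ?_
    rintro t ⟨x, a, i, hage, hi, hpos⟩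
    simp only [Set.mem_iUnion]
    exact ⟨(x, i), ⟨le_of_age_eq_some hn hage, hi.trans_le (frogs_le ω x), a, hpos⟩, a, hpos, hage⟩
  exact fun h => Nat.frequently_atTop_iff_infinite.1 h hfin

/-- Steps to the left have size one, so on its way to -∞ the initial frog cannot jump over -k. -/
theorem exists_age_neg {ω : Sample} (hdrift : Tendsto (displacement (walk (0, 0) ω.2)) atTop atBot)
    (hstep : ∀ l, -1 ≤ walk (0, 0) ω.2 l) (k : ℕ) : ∃ t, age ω t (-(k : ℤ)) = some 0 := by
  rcases Nat.eq_zero_or_pos k with rfl | hk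
  · exact ⟨0, by simpa using age_zero_origin ω⟩
  classical
  have hex : ∃ a, displacement (walk (0, 0) ω.2) a ≤ -(k : ℤ) :=
    (hdrift.eventually_le_atBot _).exists
  -- The first passage time is positive because the walk starts at 0 > -k; writing it as `c + 1`
  -- matches the time shift in `Lands`.
  obtain ⟨c, hc⟩ : ∃ c, Nat.find hex = c + 1 := by
    refine Nat.exists_eq_succ_of_ne_zero fun h0 => ?_
    have := Nat.find_spec hex
    rw [h0] at this
    simp [displacement] at this
    omega
  have h1 := Nat.find_spec hex
  have h2 := Nat.find_min hex (m := c) (by omega)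
  have h3 : displacement (walk (0, 0) ω.2) (c + 1) =
      displacement (walk (0, 0) ω.2) c + walk (0, 0) ω.2 c := Finset.sum_range_succ _ _
  have h4 := hstep c
  rw [hc] at h1
  refine exists_age_of_lands (n := c) ⟨0, c, 0, ?_, by simp [frogs], ?_⟩
  · simpa using age_add_of_some (age_zero_origin ω) c
  · rw [position_eq]
    omega

theorem mem_originVisitedIO {ω : Sample}
    (hdrift : Tendsto (displacement (walk (0, 0) ω.2)) atTop atBot)
    (hstep : ∀ l, -1 ≤ walk (0, 0) ω.2 l)
    (hstraight : ∃ᶠ k : ℕ in atTop, ∃ i < ω.1 (-(k : ℤ)),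
      ∀ l < k, walk (-(k : ℤ), i) ω.2 l = 1) :
    ω ∈ originVisitedIO := by
  refine frequently_atTop.2 fun N => ?_
  -- Taking k ≥ N + 1 makes the arrival time t + k at least N, and keeps -k away from the origin,
  -- where the count is not `ω.1`.
  obtain ⟨k, hk, i, hi, hl⟩ := frequently_atTop.1 hstraight (N + 1)
  obtain ⟨t, ht⟩ := exists_age_neg hdrift hstep k
  refine ⟨t + k, by omega, -(k : ℤ), 0 + k, i, age_add_of_some ht k, ?_, ?_⟩
  · rwa [frogs, if_neg (by omega)]
  · rw [position_eq, displacement, Finset.sum_congr rfl fun l h => hl l (by simpa using h)]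
    simp

/-! ### Measurability of the event and transfer to all walks -/

theorem measurable_frogs (x : ℤ) : Measurable fun ω : Sample => frogs ω x := by
  unfold frogs
  split_ifs <;> fun_prop

theorem measurable_position (x : ℤ) (i a : ℕ) : Measurable fun ω : Sample => position ω x i a := by
  unfold position
  fun_prop

theorem measurable_frogs_position_eq (y : ℤ) (i a : ℕ) (x : ℤ) :
    Measurable fun ω : Sample => i < frogs ω y ∧ position ω y i a = x :=
  (measurableSet_setOfPred.1 (measurableSet_lt measurable_const (measurable_frogs y))).and
    (measurableSet_setOfPred.1 (measurableSet_eq_fun (measurable_position y i a) measurable_const))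

theorem measurable_age_eq (n : ℕ) (x : ℤ) (o : Option ℕ) :
    Measurable fun ω : Sample => age ω n x = o := by
  induction n generalizing x o with
  | zero =>
    simp only [age]
    exact measurable_const
  | succ n ih =>
    have hL : Measurable fun ω : Sample => Lands ω n x :=
      Measurable.exists fun y => Measurable.exists fun a => Measurable.exists fun i =>
        (ih y (some a)).and (measurable_frogs_position_eq y i (a + 1) x)
    cases o with
    | none =>
      simp_rw [age_succ_eq_none_iff]
      exact (ih x none).and hL.not
    | some b =>
      simp_rw [age_succ_eq_some_iff]
      exact (Measurable.exists fun a => (ih x (some a)).and measurable_const).or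
        ((ih x none).and (hL.and measurable_const))

theorem measurableSet_originVisitedIO : MeasurableSet originVisitedIO := by
  have h : ∀ n, Measurable fun ω : Sample => OriginVisitedAt ω n := fun n =>
    Measurable.exists fun x => Measurable.exists fun a => Measurable.exists fun i =>
      (measurable_age_eq n x (some a)).and (measurable_frogs_position_eq x i a 0)
  have h' : originVisitedIO = {ω : Sample | ∀ N, ∃ n, N ≤ n ∧ OriginVisitedAt ω n} := by
    ext ω
    exact frequently_atTop
  rw [h', measurableSet_setOfPred]
  exact Measurable.forall fun N => Measurable.exists fun n => measurable_const.and (h n)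

theorem ae_walk {p : ℝ} [IsProbabilityMeasure (stepLaw p)] {P : (ℕ → ℤ) → Prop}
    (h : ∀ᵐ u ∂pathLaw p, P u) : ∀ᵐ s ∂stepsLaw p, ∀ z, P (walk z s) :=
  ae_all_iff.2 fun z => ae_of_ae_map (measurable_walk z).aemeasurable (by rwa [map_walk])

end FrogModel

theorem mainTheorem6 (ν : MeasureTheory.Measure ℕ) [MeasureTheory.IsProbabilityMeasure ν]
    (p : ℝ) (hp : 1 / 2 < p) (hp1 : p < 1) :
    (∫⁻ k, ENNReal.ofReal (Real.posLog (k : ℝ)) ∂ν < ⊤ →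
      FrogModel.law ν p FrogModel.originVisitedIO = 0) ∧
    (∫⁻ k, ENNReal.ofReal (Real.posLog (k : ℝ)) ∂ν = ⊤ →
      FrogModel.law ν p FrogModel.originVisitedIO = 1) := by
  have := FrogModel.isProbabilityMeasure_stepLaw (p := p) (by linarith) hp1.le
  have := FrogModel.isProbabilityMeasure_law ν (p := p) (by linarith) hp1.le
  have hρ0 : 0 < (1 - p) / p := by apply div_pos <;> linarith
  have hρ1 : (1 - p) / p < 1 := by rw [div_lt_one (by linarith)]; linarith
  have hdrift := FrogModel.ae_walk (FrogModel.ae_tendsto_displacement_atBot hp hp1)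
  constructor
  · intro hν
    -- Fubini: it suffices that for almost every configuration of counts the event is null for the
    -- walks.
    refine (Measure.measure_prod_null FrogModel.measurableSet_originVisitedIO).2 ?_
    filter_upwards [FrogModel.ae_backWeight hν hρ0 hρ1] with η ⟨hη0, M, hηM⟩
    refine measure_eq_zero_iff_ae_notMem.2 ?_
    filter_upwards [hdrift, FrogModel.ae_finite_reach hp hp1 hη0,
      FrogModel.ae_exists_barrier hp hp1 hηM] with s h1 h2 h3
    exact FrogModel.notMem_originVisitedIO (ω := (η, s)) h2 h3 h1
  · intro hν
    rw [← prob_compl_eq_zero_iff FrogModel.measurableSet_originVisitedIO]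
    refine (Measure.measure_prod_null FrogModel.measurableSet_originVisitedIO.compl).2 ?_
    filter_upwards [FrogModel.ae_frequently_one_le hν (q := 1 - p) (by linarith) (by linarith)]
      with η hη
    refine measure_eq_zero_iff_ae_notMem.2 ?_
    filter_upwards [hdrift, FrogModel.ae_walk FrogModel.ae_neg_one_le_steps,
      FrogModel.ae_frequently_straight hp1 hη] with s h1 h2 h3
    exact fun hmem => hmem (FrogModel.mem_originVisitedIO (ω := (η, s)) (h1 _) (h2 _) h3)
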